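/- Let $\mathbb K$ be a field of characteristic zero. For a finite group $G$, let $\Xi(G)$ be the slice Burnside group of $G$: the quotient of the free abelian group on the isomorphism classes $[X\xrightarrow{f}Y]$ of morphisms of finite $G$-sets by the subgroup generated by the elements $$[X_1\sqcup X_2\xrightarrow{f_1\sqcup f_2}Y]-[X_1\xrightarrow{f_1}f_1(X_1)]-[X_2\xrightarrow{f_2}f_2(X_2)],$$ and let $\mathbb K\Xi(G)=\mathbb K\otimes_{\mathbb Z}\Xi(G)$. For subgroups $S\le T\le G$, let $\langle T,S\rangle_G$ be the class of the projection $G/S\to G/T$, and let $$\xi_{T,S}^G=\frac1{|N_G(T)\cap N_G(S)|}\sum_{U\le S\le V\le T}|U|\,\mu(U,S)\,\mu(V,T)\,\langle V,U\rangle_G\in\mathbb K\Xi(G),$$ where $\mu$ is the Möbius function of the poset of subgroups of $G$. For $N\trianglelefteq G$, let $\mathrm{Def}_{G/N}^G:\mathbb K\Xi(G)\to\mathbb K\Xi(G/N)$ be the $\mathbb K$-linear map sending the class of $f:X\to Y$ to the class of $(G/N)\times_G f:(G/N)\times_G X\to(G/N)\times_G Y$, where $G/N$ is viewed as a $(G/N,G)$-biset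 by multiplication. For $S\le G$ and $N\trianglelefteq G$, put $$m_{G,S,N}=\frac{|N_G(SN):SN|}{|N_G(S)|}\sum_{\substack{U\le S\le V\le G\\ VN=G,\ UN=SN}}|U|\,\mu(U,S)\,\mu(V,G).$$ **Proposition 4.4.** Let $N$ be a normal subgroup of a finite group $G$. Then for every subgroup $S$ of $G$, $$\mathrm{Def}_{G/N}^G\,\xi_{G,S}^G=m_{G,S,N}\;\xi_{G/N,\,SN/N}^{G/N}.$$ More generally, for all subgroups $S\le T\le G$, $$\mathrm{Def}_{G/N}^G\,\xi_{T,S}^G=\frac{|N_T(S)|\;|N_G(TN)\cap N_G(SN)|}{|N_G(T)\cap N_G(S)|\;|N_{TN}(SN)|}\;m_{T,S,T\cap N}\;\xi_{TN/N,\,SN/N}^{G/N},$$ where $m_{T,S,T\cap N}$ is computed in the group $T$. -/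

import Mathlib

universe u

open scoped TensorProduct

namespace SliceBurnside

/-! ### Morphisms of finite `G`-sets and the slice Burnside group -/

/-- A morphism `f : X ⟶ Y` of finite `G`-sets. -/
structure GMor (G : Type u) [Group G] where
  X : Type u
  Y : Type u
  [actX : MulAction G X]
  [actY : MulAction G Y]
  [finX : Finite X]
  [finY : Finite Y]
  f : X →[G] Y

attribute [instance] GMor.actX GMor.actY GMor.finX GMor.finY

/-- Two morphisms of `G`-sets are isomorphic if there are isomorphisms of `G`-sets between their
sources and between their targets which form a commutative square with them. -/
def GMor.Iso {G : Type u} [Group G] (a b : GMor G) : Prop :=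
  ∃ (h : a.X ≃ b.X) (k : a.Y ≃ b.Y), (∀ (g : G) (x : a.X), h (g • x) = g • h x) ∧
    (∀ (g : G) (y : a.Y), k (g • y) = g • k y) ∧ ∀ x : a.X, k (a.f x) = b.f (h x)

instance gMorSetoid (G : Type u) [Group G] : Setoid (GMor G) where
  r := GMor.Iso
  iseqv :=
    { refl := fun _ => ⟨Equiv.refl _, Equiv.refl _, fun _ _ => rfl, fun _ _ => rfl, fun _ => rfl⟩
      symm := by
        rintro a b ⟨h, k, hh, hk, hf⟩
        refine ⟨h.symm, k.symm, fun g x => ?_, fun g y => ?_, fun x => ?_⟩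
        · rw [Equiv.symm_apply_eq, hh, Equiv.apply_symm_apply]
        · rw [Equiv.symm_apply_eq, hk, Equiv.apply_symm_apply]
        · rw [Equiv.symm_apply_eq, hf, Equiv.apply_symm_apply]
      trans := by
        rintro a b c ⟨h, k, hh, hk, hf⟩ ⟨h', k', hh', hk', hf'⟩
        refine ⟨h.trans h', k.trans k', fun g x => ?_, fun g y => ?_, fun x => ?_⟩
        · simp [hh, hh']
        · simp [hk, hk']
        · simp [hf, hf'] }

/-- Isomorphism classes of morphisms of finite `G`-sets. -/
abbrev GMorClass (G : Type u) [Group G] : Type (u + 1) := Quotient (gMorSetoid G)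

section maps

variable {G : Type u} [Group G] {X X₁ X₂ Y : Type u}
  [MulAction G X] [MulAction G X₁] [MulAction G X₂] [MulAction G Y]

/-- The image of a morphism of `G`-sets, as a sub-`G`-set of its target. -/
def image (f : X →[G] Y) : SubMulAction G Y where
  carrier := Set.range f
  smul_mem' := by
    rintro g _ ⟨x, rfl⟩
    exact ⟨g • x, map_smul f g x⟩

/-- The corestriction `X ⟶ f(X)` of a morphism of `G`-sets `f : X ⟶ Y`. -/
def toImage (f : X →[G] Y) : X →[G] image f where
  toFun x := ⟨f x, x, rfl⟩
  map_smul' g x := Subtype.ext (map_smul f g x)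

/-- The morphism `X₁ ⊔ X₂ ⟶ Y` with components `f₁ : X₁ ⟶ Y` and `f₂ : X₂ ⟶ Y`. -/
def sumElim (f₁ : X₁ →[G] Y) (f₂ : X₂ →[G] Y) : (X₁ ⊕ X₂) →[G] Y where
  toFun := Sum.elim f₁ f₂
  map_smul' g x := by
    cases x with
    | inl x => exact map_smul f₁ g x
    | inr x => exact map_smul f₂ g x

end maps

/-- The class of a morphism of finite `G`-sets in the free abelian group on the isomorphism
classes. -/
def cls {G : Type u} [Group G] (a : GMor G) : FreeAbelianGroup (GMorClass G) :=
  FreeAbelianGroup.of (Quotient.mk (gMorSetoid G) a)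

/-- The defining relations of the slice Burnside group:
`[X₁ ⊔ X₂ ⟶ Y] - [X₁ ⟶ f₁(X₁)] - [X₂ ⟶ f₂(X₂)]`. -/
inductive IsRel (G : Type u) [Group G] : FreeAbelianGroup (GMorClass G) → Prop
  | mk (X₁ X₂ Y : Type u) [MulAction G X₁] [MulAction G X₂] [MulAction G Y]
      [Finite X₁] [Finite X₂] [Finite Y] (f₁ : X₁ →[G] Y) (f₂ : X₂ →[G] Y) :
      IsRel G (cls ⟨X₁ ⊕ X₂, Y, sumElim f₁ f₂⟩ - cls ⟨X₁, image f₁, toImage f₁⟩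
        - cls ⟨X₂, image f₂, toImage f₂⟩)

/-- The subgroup generated by the defining relations. -/
def relations (G : Type u) [Group G] : AddSubgroup (FreeAbelianGroup (GMorClass G)) :=
  AddSubgroup.closure {r | IsRel G r}

/-- The slice Burnside group `Ξ(G)`. -/
abbrev Xi (G : Type u) [Group G] : Type (u + 1) :=
  FreeAbelianGroup (GMorClass G) ⧸ relations G

/-- The image `π(f)` in `Ξ(G)` of the isomorphism class of a morphism `f` of finite `G`-sets. -/
def piCls {G : Type u} [Group G] (a : GMor G) : Xi G :=
  QuotientAddGroup.mk (cls a)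

/-! ### The action of bisets -/

section bisets

variable {H G : Type u} [Group H] [Group G]

/-- For a right `G`-set `U` and a left `G`-set `X`, the equivalence relation on `U × X` whose
classes are the orbits of the action `(u, x) · g = (u g, g⁻¹ x)` of `G`. -/
def tensorSetoid (G : Type u) [Group G] (U X : Type u) [MulAction Gᵐᵒᵖ U] [MulAction G X] :
    Setoid (U × X) where
  r p q := ∃ g : G, q = (MulOpposite.op g • p.1, g⁻¹ • p.2)
  iseqv :=
    { refl := fun p => ⟨1, by simp⟩
      symm := by
        rintro ⟨u, x⟩ _ ⟨g, rfl⟩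
        exact ⟨g⁻¹, by simp⟩
      trans := by
        rintro ⟨u, x⟩ _ _ ⟨g, rfl⟩ ⟨g', rfl⟩
        exact ⟨g * g', by simp [mul_smul]⟩ }

/-- The set `U ×_G X`. -/
def Tensor (G : Type u) [Group G] (U X : Type u) [MulAction Gᵐᵒᵖ U] [MulAction G X] : Type u :=
  Quotient (tensorSetoid G U X)

variable (U : Type u) [MulAction H U] [MulAction Gᵐᵒᵖ U] [SMulCommClass H Gᵐᵒᵖ U]

/-- The element `(u, _G x)` of `U ×_G X`. -/
def tmk {U X : Type u} [MulAction Gᵐᵒᵖ U] [MulAction G X] (u : U) (x : X) : Tensor G U X :=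
  Quotient.mk (tensorSetoid G U X) (u, x)

theorem tmk_eq_iff {U X : Type u} [MulAction Gᵐᵒᵖ U] [MulAction G X] {u u' : U} {x x' : X} :
    (tmk u x : Tensor G U X) = tmk u' x' ↔
      ∃ g : G, u' = MulOpposite.op g • u ∧ x' = g⁻¹ • x := by
  refine Quotient.eq.trans ⟨?_, ?_⟩
  · rintro ⟨g, hg⟩
    exact ⟨g, congrArg Prod.fst hg, congrArg Prod.snd hg⟩
  · rintro ⟨g, rfl, rfl⟩
    exact ⟨g, rfl⟩

@[elab_as_elim]
theorem tensor_ind {U X : Type u} [MulAction Gᵐᵒᵖ U] [MulAction G X] {p : Tensor G U X → Prop}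
    (h : ∀ u x, p (tmk u x)) (t : Tensor G U X) : p t :=
  Quotient.inductionOn t fun q => h q.1 q.2

/-- Functions out of `U ×_G X`. -/
def tlift {U X : Type u} [MulAction Gᵐᵒᵖ U] [MulAction G X] {Z : Type u} (F : U → X → Z)
    (hF : ∀ (g : G) u x, F (MulOpposite.op g • u) (g⁻¹ • x) = F u x) (t : Tensor G U X) : Z :=
  Quotient.lift (s := tensorSetoid G U X) (fun q => F q.1 q.2)
    (by rintro p _ ⟨g, rfl⟩; exact (hF g p.1 p.2).symm) t

instance tensorFinite {X : Type u} [MulAction G X] [Finite U] [Finite X] :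
    Finite (Tensor G U X) :=
  inferInstanceAs (Finite (Quotient (tensorSetoid G U X)))

/-- If `U` is an `(H, G)`-biset, then `H` acts on `U ×_G X` by `h (u, _G x) = (h u, _G x)`. -/
instance tensorAction {X : Type u} [MulAction G X] : MulAction H (Tensor G U X) where
  smul h t := tlift (fun u x => (tmk (h • u) x : Tensor G U X))
    (fun g u _ => (tmk_eq_iff.2 ⟨g, smul_comm h (MulOpposite.op g) u, rfl⟩).symm) t
  one_smul t := tensor_ind (fun u _ => congrArg (fun v => (tmk v _ : Tensor G U X)) (one_smul H u)) t
  mul_smul a b t := tensor_ind (fun u x => congrArg (fun v => (tmk v x : Tensor G U X)) (mul_smul a b u)) t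

theorem smul_tmk {X : Type u} [MulAction G X] (h : H) (u : U) (x : X) :
    h • (tmk u x : Tensor G U X) = tmk (h • u) x := rfl

/-- The morphism of `H`-sets `U ×_G f : U ×_G X ⟶ U ×_G Y`, `(u, _G x) ↦ (u, _G f x)`. -/
def tensorMap {X Y : Type u} [MulAction G X] [MulAction G Y] (f : X →[G] Y) :
    Tensor G U X →[H] Tensor G U Y where
  toFun := tlift (fun u x => (tmk u (f x) : Tensor G U Y))
    (fun g _ x => (tmk_eq_iff.2 ⟨g, rfl, map_smul f g⁻¹ x⟩).symm)
  map_smul' _ t := tensor_ind (fun _ _ => rfl) t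

theorem tensorMap_tmk {X Y : Type u} [MulAction G X] [MulAction G Y] (f : X →[G] Y) (u : U)
    (x : X) : tensorMap (H := H) U f (tmk u x) = tmk u (f x) := rfl

variable [Finite U]

/-- The morphism of finite `H`-sets `U ×_G f`. -/
def bisetMor (a : GMor G) : GMor H := ⟨Tensor G U a.X, Tensor G U a.Y, tensorMap U a.f⟩

/-- An isomorphism of `G`-sets induces a bijection on `U ×_G -`. -/
def tensorEquiv {X Y : Type u} [MulAction G X] [MulAction G Y] (e : X ≃ Y)
    (he : ∀ (g : G) x, e (g • x) = g • e x) : Tensor G U X ≃ Tensor G U Y where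
  toFun := tlift (fun u x => (tmk u (e x) : Tensor G U Y))
    (fun g u x => (tmk_eq_iff.2 ⟨g, rfl, he g⁻¹ x⟩).symm)
  invFun := tlift (fun u y => (tmk u (e.symm y) : Tensor G U X))
    (fun g u y => (tmk_eq_iff.2 ⟨g, rfl, by rw [Equiv.symm_apply_eq, he, e.apply_symm_apply]⟩).symm)
  left_inv t := tensor_ind (fun u x => congrArg (tmk u) (e.symm_apply_apply x)) t
  right_inv t := tensor_ind (fun u x => congrArg (tmk u) (e.apply_symm_apply x)) t

theorem bisetMor_iso {a b : GMor G} (hab : a.Iso b) :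
    (bisetMor (H := H) U a).Iso (bisetMor U b) := by
  obtain ⟨h, k, hh, hk, hf⟩ := hab
  exact ⟨tensorEquiv U h hh, tensorEquiv U k hk, fun g t => tensor_ind (fun _ _ => rfl) t,
    fun g t => tensor_ind (fun _ _ => rfl) t,
    fun t => tensor_ind (fun u x => congrArg (tmk u) (hf x)) t⟩

/-- The additive map on free abelian groups induced by `f ↦ U ×_G f`. -/
def bisetFree : FreeAbelianGroup (GMorClass G) →+ FreeAbelianGroup (GMorClass H) :=
  FreeAbelianGroup.map
    (Quotient.map (sa := gMorSetoid G) (sb := gMorSetoid H) (bisetMor (H := H) U)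
      fun _ _ h => bisetMor_iso U h)

theorem bisetFree_cls (a : GMor G) : bisetFree (H := H) U (cls a) = cls (bisetMor U a) :=
  FreeAbelianGroup.map_of_apply _

theorem cls_eq {a b : GMor G} (h : a.Iso b) : cls a = cls b :=
  congrArg FreeAbelianGroup.of (Quotient.sound (s := gMorSetoid G) h)

theorem bisetMor_sum_iso (X₁ X₂ Y : Type u) [MulAction G X₁] [MulAction G X₂] [MulAction G Y]
    [Finite X₁] [Finite X₂] [Finite Y] (f₁ : X₁ →[G] Y) (f₂ : X₂ →[G] Y) :
    (bisetMor (H := H) U ⟨X₁ ⊕ X₂, Y, sumElim f₁ f₂⟩).Iso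
      ⟨Tensor G U X₁ ⊕ Tensor G U X₂, Tensor G U Y,
        sumElim (tensorMap U f₁) (tensorMap U f₂)⟩ := by
  let e : Tensor G U (X₁ ⊕ X₂) ≃ Tensor G U X₁ ⊕ Tensor G U X₂ :=
    { toFun := tlift (fun u x => Sum.map (tmk u) (tmk u) x) (by
        rintro g u (x | x)
        · exact congrArg Sum.inl (tmk_eq_iff (u := u) (x := x).2 ⟨g, rfl, rfl⟩).symm
        · exact congrArg Sum.inr (tmk_eq_iff (u := u) (x := x).2 ⟨g, rfl, rfl⟩).symm)
      invFun := Sum.elim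
        (tlift (fun u x => (tmk u (Sum.inl x) : Tensor G U (X₁ ⊕ X₂)))
          (fun g u x => (tmk_eq_iff (u := u) (x := (Sum.inl x : X₁ ⊕ X₂)).2 ⟨g, rfl, rfl⟩).symm))
        (tlift (fun u x => (tmk u (Sum.inr x) : Tensor G U (X₁ ⊕ X₂)))
          (fun g u x => (tmk_eq_iff (u := u) (x := (Sum.inr x : X₁ ⊕ X₂)).2 ⟨g, rfl, rfl⟩).symm))
      left_inv := fun t => tensor_ind (by rintro u (x | x) <;> rfl) t
      right_inv := by
        rintro (t | t)
        · exact tensor_ind (fun _ _ => rfl) t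
        · exact tensor_ind (fun _ _ => rfl) t }
  exact ⟨e, Equiv.refl _, fun g t => tensor_ind (by rintro u (x | x) <;> rfl) t,
    fun _ _ => rfl, fun t => tensor_ind (by rintro u (x | x) <;> rfl) t⟩

theorem bisetMor_image_iso (X Y : Type u) [MulAction G X] [MulAction G Y]
    [Finite X] [Finite Y] (f : X →[G] Y) :
    (bisetMor (H := H) U ⟨X, image f, toImage f⟩).Iso
      ⟨Tensor G U X, image (tensorMap (H := H) U f), toImage (tensorMap U f)⟩ := by
  let k : Tensor G U (image f) → image (tensorMap (H := H) U f) := fun t =>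
    ⟨tensorMap (H := H) U (image f).subtype t, by
      refine tensor_ind ?_ t
      rintro u ⟨_, x, rfl⟩
      exact ⟨tmk u x, rfl⟩⟩
  have hk : Function.Bijective k := by
    constructor
    · refine tensor_ind fun u y => tensor_ind fun u' y' h => ?_
      obtain ⟨g, hu, hy⟩ := tmk_eq_iff.1 (congrArg Subtype.val h)
      exact tmk_eq_iff.2 ⟨g, hu, Subtype.ext hy⟩
    · rintro ⟨_, t, rfl⟩
      refine tensor_ind (fun u x => ?_) t
      exact ⟨tmk u (toImage f x), rfl⟩
  refine ⟨Equiv.refl _, Equiv.ofBijective k hk, fun _ _ => rfl, fun g t => ?_, fun t => ?_⟩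
  · exact Subtype.ext (map_smul (tensorMap (H := H) U (image f).subtype) g t)
  · exact tensor_ind (fun _ _ => rfl) t

theorem bisetFree_relations :
    relations G ≤ (relations H).comap (bisetFree (H := H) (G := G) U) := by
  refine (AddSubgroup.closure_le _).2 ?_
  rintro _ ⟨X₁, X₂, Y, f₁, f₂⟩
  change bisetFree U _ ∈ relations H
  rw [map_sub, map_sub, bisetFree_cls, bisetFree_cls, bisetFree_cls,
    cls_eq (bisetMor_sum_iso U X₁ X₂ Y f₁ f₂), cls_eq (bisetMor_image_iso U X₁ Y f₁),
    cls_eq (bisetMor_image_iso U X₂ Y f₂)]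
  exact AddSubgroup.subset_closure ⟨_, _, _, tensorMap U f₁, tensorMap U f₂⟩

/-- The homomorphism `Ξ(U) : Ξ(G) ⟶ Ξ(H)`, `π(f) ↦ π(U ×_G f)`, induced by a finite
`(H, G)`-biset `U`. -/
def xiMap : Xi G →+ Xi H :=
  QuotientAddGroup.map _ _ (bisetFree (H := H) U) (bisetFree_relations U)

theorem xiMap_piCls (a : GMor G) : xiMap (H := H) U (piCls a) = piCls (bisetMor U a) :=
  congrArg (QuotientAddGroup.mk (s := relations H)) (bisetFree_cls U a)

end bisets

/-- `KΞ(G) = K ⊗ Ξ(G)`. -/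
abbrev KXi (K : Type*) [Field K] (G : Type u) [Group G] : Type _ := K ⊗[ℤ] Xi G

/-- The left multiplication by `G/N` and the right multiplication by images of elements of `G`
on `G/N` commute. -/
instance quotientBiset {G : Type u} [Group G] (N : Subgroup G) [N.Normal] :
    SMulCommClass (G ⧸ N) Gᵐᵒᵖ (G ⧸ N) where
  smul_comm a b c := by
    induction a using QuotientGroup.induction_on
    induction c using QuotientGroup.induction_on
    exact congrArg (QuotientGroup.mk (s := N)) (mul_assoc _ _ _).symm

/-- The deflation `Def_{G/N}^G : KΞ(G) ⟶ KΞ(G/N)`: the `K`-linear map induced by `G/N`, viewed as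
a `(G/N, G)`-biset. -/
noncomputable def deflation (K : Type*) [Field K] {G : Type u} [Group G] [Finite G]
    (N : Subgroup G) [N.Normal] : KXi K G →ₗ[K] KXi K (G ⧸ N) :=
  LinearMap.baseChange K (xiMap (H := G ⧸ N) (G := G) (G ⧸ N)).toIntLinearMap

/-! ### The elements `⟨T, S⟩_G`, `ξ_{T,S}^G` and the constants `m_{G,S,N}` -/

section slices

variable {G : Type u} [Group G]

/-- The projection `G/S ⟶ G/T` for `S ≤ T`. -/
def projection (T S : Subgroup G) (h : S ≤ T) : (G ⧸ S) →[G] (G ⧸ T) where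
  toFun := Subgroup.quotientMapOfLE h
  map_smul' g x := by
    induction x using QuotientGroup.induction_on
    rfl

variable [Finite G]

/-- `⟨T, S⟩_G = π(G/S ⟶ G/T)` for a slice `(T, S)` of `G`. -/
def bracket (T S : Subgroup G) (h : S ≤ T) : Xi G :=
  piCls ⟨G ⧸ S, G ⧸ T, projection T S h⟩

/-- The Möbius function of the poset of subgroups of `G`. -/
noncomputable def mu (A B : Subgroup G) : ℤ :=
  letI : Fintype (Subgroup G) := Fintype.ofFinite _
  letI : DecidableEq (Subgroup G) := Classical.decEq _
  letI : DecidableLE (Subgroup G) := Classical.decRel _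
  letI : DecidableLT (Subgroup G) := Classical.decRel _
  letI : LocallyFiniteOrder (Subgroup G) := Fintype.toLocallyFiniteOrder
  IncidenceAlgebra.mu ℤ A B

/-- `N_G(S)`. -/
abbrev nz (S : Subgroup G) : Subgroup G := Subgroup.normalizer (S : Set G)

/-- `ξ_{T,S}^G = 1 / |N_G(T, S)| * ∑_{U ≤ S ≤ V ≤ T} |U| μ(U, S) μ(V, T) ⟨V, U⟩_G` in `KΞ(G)`,
where `N_G(T, S) = N_G(T) ∩ N_G(S)`. -/
noncomputable def xi (K : Type*) [Field K] (T S : Subgroup G) : KXi K G :=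
  ((Nat.card (nz T ⊓ nz S : Subgroup G) : K))⁻¹ •
    ∑ᶠ (U : {U : Subgroup G // U ≤ S}) (V : {V : Subgroup G // S ≤ V ∧ V ≤ T}),
      ((Nat.card U.1 : K) * (mu U.1 S : K) * (mu V.1 T : K)) •
        ((1 : K) ⊗ₜ[ℤ] bracket V.1 U.1 (U.2.trans V.2.1))

/-- `m_{G,S,N} = |N_G(SN) : SN| / |N_G(S)| * ∑ |U| μ(U, S) μ(V, G)`, where the sum runs over the
pairs `U ≤ S ≤ V ≤ G` with `VN = G` and `UN = SN`. (For `N` normal, `AN` is the join `A ⊔ N`.) -/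
noncomputable def mConst (S N : Subgroup G) : ℚ :=
  ((S ⊔ N).relIndex (nz (S ⊔ N)) : ℚ) / (Nat.card (nz S) : ℚ) *
    ∑ᶠ (U : {U : Subgroup G // U ≤ S ∧ U ⊔ N = S ⊔ N})
      (V : {V : Subgroup G // S ≤ V ∧ V ⊔ N = ⊤}),
      (Nat.card U.1 : ℚ) * (mu U.1 S : ℚ) * (mu V.1 ⊤ : ℚ)

end slices

end SliceBurnside

namespace SliceBurnside

/-! Write `φ : G → G/N`. Deflation sends `⟨V, U⟩` to `⟨φ(V), φ(U)⟩`, so the coefficient of `⟨B, A⟩`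
in the deflation of `ξ_{T,S}` is, up to `1/|N_G(T,S)|`, the product of the sum of `|U| μ(U,S)` over
`φ(U) = A` and the sum of `μ(V,T)` over `S ≤ V`, `φ(V) = B`. The deflated element is a multiple of
`ξ_{φ(T),φ(S)}` as soon as these fibre sums are proportional to `|A| μ(A,φ(S))` and, for `φ(S) ≤ B`,
to `μ(B,φ(T))`.

This is `sum_mu_map_eq`: a weight on subgroups that is unchanged when `U` is replaced by `U ∩
φ⁻¹(C)` has fibre sums proportional to the Möbius function of the quotient. By Möbius inversion it
is enough to compare sums over the subgroups above `C`, and for `C < φ(T)` Weisner's theorem makes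
these vanish. The weights used are `|U ∩ N|` (where `|U| = |φ(U)| |U ∩ N|`) and the indicator of `S
≤ V`.

The resulting scalar, `deflation_xi`, is a product of the fibre sums over `φ(S)` and `φ(T)` and of
orders of normalizers. For `T = G` it is `m_{G,S,N}`. For general `T`, the sums defining
`m_{T,S,T∩N}` are the same sums read inside `T`, and the remaining factor comes from comparing
orders of normalizers through the correspondence theorem. -/

theorem card_map_mul_card_inf_ker {G H : Type*} [Group G] [Group H] (φ : G →* H) (U : Subgroup G) :
    Nat.card (U.map φ) * Nat.card (U ⊓ φ.ker : Subgroup G) = Nat.card U := by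
  have h := Subgroup.card_mul_index (φ.ker.subgroupOf U)
  rw [← Subgroup.relIndex, Subgroup.relIndex_ker] at h
  rw [← h, mul_comm, inf_comm, ← Subgroup.subgroupOf_map_subtype,
    Subgroup.card_map_of_injective U.subtype_injective]

theorem card_comap {G H : Type*} [Group G] [Group H] (φ : G →* H) (C : Subgroup H) :
    Nat.card (C.comap φ) = Nat.card (φ.range ⊓ C : Subgroup H) * Nat.card φ.ker := by
  rw [← card_map_mul_card_inf_ker φ, Subgroup.map_comap_eq, inf_eq_right.2 (φ.ker_le_comap C)]

/-! ### Möbius function of the subgroup lattice: Weisner's theorem and sums over fibres -/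

section moebius

open scoped Classical

/-- A function on a finite poset whose sums over upper intervals vanish is zero. -/
theorem eq_zero_of_upper_sums {α M : Type*} [PartialOrder α] [Fintype α] [AddCommGroup M]
    (g : α → M) (b : α) (h : ∀ c, b ≤ c → ∑ a with c ≤ a, g a = 0) :
    ∀ a, b ≤ a → g a = 0 := by
  intro a
  -- Descending induction: all terms strictly above `a` already vanish, so the sum over `c ≥ a`
  -- reduces to `g a`.
  induction a using (wellFounded_gt (α := α)).induction with
  | _ a ih =>
    intro hb
    rw [← h a hb, Finset.sum_eq_single_of_mem a (by simp)]
    intro c hc hca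
    have hac : a ≤ c := (Finset.mem_filter.1 hc).2
    exact ih c (lt_of_le_of_ne hac hca.symm) (hb.trans hac)

noncomputable local instance subgroupFintype {G : Type*} [Group G] [Finite G] :
    Fintype (Subgroup G) := Fintype.ofFinite _

variable {G : Type*} [Group G] [Finite G]

theorem mu_refl (A : Subgroup G) : mu A A = 1 := by
  unfold mu
  exact @IncidenceAlgebra.mu_self ..

theorem mu_eq_zero_of_not_le {A B : Subgroup G} (h : ¬ A ≤ B) : mu A B = 0 := by
  unfold mu
  exact IncidenceAlgebra.apply_eq_zero_of_not_le h _

/-- As `mu V T` vanishes unless `V ≤ T`, the defining sum over the interval from `C` to `T` may run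
over all `V ≥ C`, with no relation assumed between `C` and `T`. -/
theorem sum_mu (C T : Subgroup G) : ∑ V with C ≤ V, mu V T = if C = T then 1 else 0 := by
  let _ : DecidableLE (Subgroup G) := Classical.decRel _
  let _ : DecidableLT (Subgroup G) := Classical.decRel _
  let _ : LocallyFiniteOrder (Subgroup G) := Fintype.toLocallyFiniteOrder
  have h := IncidenceAlgebra.sum_Icc_mu_left (𝕜 := ℤ) C T
  rw [← h]
  symm
  have hsub : Finset.Icc C T ⊆ Finset.univ.filter (C ≤ ·) := fun V hV => by
    simpa using (Finset.mem_Icc.1 hV).1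
  refine Eq.trans ?_ (Finset.sum_subset hsub ?_)
  · refine Finset.sum_congr rfl fun V _ => ?_
    unfold mu
    congr!
  · intro V hV hV'
    refine mu_eq_zero_of_not_le fun hVT => hV' ?_
    exact Finset.mem_Icc.2 ⟨(Finset.mem_filter.1 hV).2, hVT⟩

variable {R : Type*} [CommRing R]

theorem sum_mu_cast (C T : Subgroup G) :
    ∑ V with C ≤ V, (mu V T : R) = if C = T then 1 else 0 := by
  have := congrArg (Int.cast : ℤ → R) (sum_mu C T)
  push_cast at this
  exact this

/-- Weisner's theorem for the lattice of subgroups. -/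
theorem sum_mu_inf_eq {C T : Subgroup G} (h : ¬ T ≤ C) (W : Subgroup G) :
    ∑ V with V ⊓ C = W, (mu V T : R) = 0 := by
  refine eq_zero_of_upper_sums (fun W => ∑ V with V ⊓ C = W, (mu V T : R)) ⊥ ?_ W bot_le
  intro X _
  have h1 : ∑ A with X ≤ A, ∑ V with V ⊓ C = A, (mu V T : R)
      = ∑ V with X ≤ V ⊓ C, (mu V T : R) := by
    simp_rw [Finset.sum_filter]
    have : ∀ A : Subgroup G, (if X ≤ A then ∑ V, (if V ⊓ C = A then (mu V T : R) else 0) else 0)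
        = ∑ V, if V ⊓ C = A then (if X ≤ V ⊓ C then (mu V T : R) else 0) else 0 := by
      intro A
      split_ifs with hA
      · refine Finset.sum_congr rfl fun V _ => ?_
        split_ifs with h1 h2
        · rfl
        · exact absurd (h1 ▸ hA) h2
        · rfl
      · refine (Finset.sum_eq_zero fun V _ => ?_).symm
        split_ifs with h1 h2
        · exact absurd (h1 ▸ h2) hA
        all_goals rfl
    simp_rw [this]
    rw [Finset.sum_comm]
    simp
  rw [h1]
  -- For `X ≤ C` the condition `X ≤ V ⊓ C` is just `X ≤ V`, and the sum over such `V` is zero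
  -- because `X = T` would force `T ≤ C`. Otherwise the sum is empty.
  by_cases hX : X ≤ C
  · have hXT : X ≠ T := fun e => h (e ▸ hX)
    simpa [hX, hXT] using sum_mu_cast (R := R) X T
  · simp [hX]

/-- The form in which Weisner's theorem is applied: a weight depending only on `V ⊓ C` is constant
on each of its fibre sums. -/
theorem sum_inf_mul_mu {C T : Subgroup G} (h : ¬ T ≤ C) (F : Subgroup G → R) :
    ∑ V, F (V ⊓ C) * (mu V T : R) = 0 := by
  rw [← Finset.sum_fiberwise _ (fun V => V ⊓ C)]
  refine Finset.sum_eq_zero fun W _ => ?_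
  have : ∀ V ∈ Finset.univ.filter (fun V => V ⊓ C = W),
      F (V ⊓ C) * (mu V T : R) = F W * (mu V T : R) := by
    intro V hV
    rw [(Finset.mem_filter.1 hV).2]
  rw [Finset.sum_congr rfl this, ← Finset.mul_sum, sum_mu_inf_eq h, mul_zero]

variable {H : Type*} [Group H] [Finite H]

/-- Weighted sums of the Möbius function over the fibres of the direct image map `U ↦ φ(U)` on
subgroups are proportional to the Möbius function of the target. -/
theorem sum_mu_map_eq (φ : G →* H) (F : Subgroup G → R) (B : Subgroup H)
    (hF : ∀ C, B ≤ C → ∀ U, F (U ⊓ C.comap φ) = F U) (T : Subgroup G) (A : Subgroup H)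
    (hA : B ≤ A) :
    ∑ U : Subgroup G with U.map φ = A, F U * (mu U T : R)
      = (mu A (T.map φ) : R) * ∑ U : Subgroup G with U.map φ = T.map φ, F U * (mu U T : R) := by
  set β : R := ∑ U : Subgroup G with U.map φ = T.map φ, F U * (mu U T : R) with hβ
  rw [← sub_eq_zero]
  refine eq_zero_of_upper_sums
    (fun A => ∑ U : Subgroup G with U.map φ = A, F U * (mu U T : R) - (mu A (T.map φ) : R) * β) B ?_ A hA
  intro C hC
  rw [Finset.sum_sub_distrib, ← Finset.sum_mul, sum_mu_cast]
  have h1 : ∑ A with C ≤ A, ∑ U : Subgroup G with U.map φ = A, F U * (mu U T : R)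
      = ∑ U : Subgroup G with C ≤ U.map φ, F U * (mu U T : R) := by
    simp_rw [Finset.sum_filter]
    rw [← Finset.sum_fiberwise _ (fun U : Subgroup G => U.map φ)]
    refine Finset.sum_congr rfl fun A _ => ?_
    rw [Finset.sum_filter]
    split_ifs with hA
    · refine Finset.sum_congr rfl fun U _ => ?_
      split_ifs with h1 h2
      · rfl
      · exact absurd (h1 ▸ hA) h2
      · rfl
    · refine (Finset.sum_eq_zero fun U _ => ?_).symm
      split_ifs with h1 h2
      · exact absurd (h1 ▸ h2) hA
      all_goals rfl
  rw [h1]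
  -- Three cases for the upper sum at `C`: it is `β` if `C = φ(T)`, zero by Weisner if `C < φ(T)`,
  -- and zero term by term if `C` is not contained in `φ(T)`.
  by_cases hCT : C ≤ T.map φ
  · rcases eq_or_lt_of_le hCT with rfl | hlt
    · rw [if_pos rfl, one_mul, hβ, sub_eq_zero, Finset.sum_filter, Finset.sum_filter]
      refine Finset.sum_congr rfl fun U _ => ?_
      by_cases hU : U ≤ T
      · simp only [le_antisymm_iff, Subgroup.map_mono hU, true_and]
      · simp [mu_eq_zero_of_not_le hU]
    · rw [if_neg hlt.ne, zero_mul, sub_zero]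
      have hTC : ¬ T ≤ C.comap φ := fun h => hlt.not_ge (Subgroup.map_le_iff_le_comap.2 h)
      -- Both the condition `C ≤ φ(U)` and the weight `F U` depend only on `U ⊓ φ⁻¹(C)`, the second
      -- by `hF`.
      rw [← sum_inf_mul_mu hTC (fun W => if C ≤ W.map φ then F W else 0), Finset.sum_filter]
      refine Finset.sum_congr rfl fun U _ => ?_
      have : C ≤ (U ⊓ C.comap φ).map φ ↔ C ≤ U.map φ := by
        refine ⟨fun h => h.trans (Subgroup.map_mono inf_le_left), fun h x hx => ?_⟩
        obtain ⟨y, hy, rfl⟩ := h hx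
        exact ⟨y, ⟨hy, hx⟩, rfl⟩
      simp only [this, hF C hC U]
      split_ifs <;> simp
  · have hne : C ≠ T.map φ := fun e => hCT e.le
    rw [if_neg hne, zero_mul, sub_zero]
    refine Finset.sum_eq_zero fun U hU => ?_
    have hU' := (Finset.mem_filter.1 hU).2
    rw [mu_eq_zero_of_not_le fun h => hCT (hU'.trans (Subgroup.map_mono h))]
    simp

/-- In `|U| = |φ(U)| |U ∩ ker φ|` the first factor is constant on the fibre. The second is an
admissible weight for every `C`, since `φ⁻¹(C)` contains the kernel. -/
theorem sum_card_mu_map_eq (φ : G →* H) (S : Subgroup G) (A : Subgroup H) :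
    ∑ U : Subgroup G with U.map φ = A, (Nat.card U : R) * (mu U S : R)
      = (Nat.card A : R) * (mu A (S.map φ) : R) *
        ∑ U : Subgroup G with U.map φ = S.map φ, (Nat.card (U ⊓ φ.ker : Subgroup G) : R) * (mu U S : R) := by
  have h := sum_mu_map_eq φ (fun U => (Nat.card (U ⊓ φ.ker : Subgroup G) : R)) ⊥ (by
    intro C _ U
    have : U ⊓ C.comap φ ⊓ φ.ker = U ⊓ φ.ker := by
      rw [inf_assoc, inf_eq_right.2 (φ.ker_le_comap C)]
    simp only [this]) S A bot_le
  rw [mul_assoc, ← h, Finset.mul_sum]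
  refine Finset.sum_congr rfl fun U hU => ?_
  rw [← card_map_mul_card_inf_ker φ U, (Finset.mem_filter.1 hU).2]
  push_cast
  ring

/-- The indicator of `S ≤ V` survives intersection with `φ⁻¹(C)` when `φ(S) ≤ C`; this is what the
lower bound `B` in `sum_mu_map_eq` is for. If `φ(S)` is not contained in `A`, both sides vanish. -/
theorem sum_le_mu_map_eq (φ : G →* H) (S T : Subgroup G) (A : Subgroup H) :
    ∑ V : Subgroup G with V.map φ = A, (if S ≤ V then 1 else 0) * (mu V T : R)
      = (if S.map φ ≤ A then 1 else 0) * (mu A (T.map φ) : R) *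
        ∑ V : Subgroup G with V.map φ = T.map φ, (if S ≤ V then 1 else 0) * (mu V T : R) := by
  by_cases hA : S.map φ ≤ A
  · rw [if_pos hA, one_mul]
    refine sum_mu_map_eq φ (fun V => if S ≤ V then 1 else 0) (S.map φ) ?_ T A hA
    intro C hC V
    simp only [le_inf_iff, Subgroup.map_le_iff_le_comap.1 hC, and_true]
  · rw [if_neg hA, zero_mul, zero_mul]
    refine Finset.sum_eq_zero fun V hV => ?_
    rw [if_neg, zero_mul]
    intro h
    exact hA ((Finset.mem_filter.1 hV).2 ▸ Subgroup.map_mono h)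

end moebius

end SliceBurnside

namespace SliceBurnside

/-! ### Deflation of slices and of the elements `ξ_{T,S}` -/

section deflation

open scoped Classical

variable {G : Type u} [Group G]

theorem tmk_quotient_eq (N : Subgroup G) [N.Normal] {X : Type u} [MulAction G X] (a : G ⧸ N)
    (g : G) (x : X) : (tmk a (g • x) : Tensor G (G ⧸ N) X) = tmk (a * (g : G ⧸ N)) x := by
  refine tmk_eq_iff.2 ⟨g, ?_, (inv_smul_smul g x).symm⟩
  induction a using QuotientGroup.induction_on
  rfl

/-- The isomorphism `(G/N) ×_G (G/U) ≃ (G/N)/(UN/N)` of `G/N`-sets. -/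
noncomputable def tensorQuotientEquiv (N U : Subgroup G) [N.Normal] :
    Tensor G (G ⧸ N) (G ⧸ U) ≃ (G ⧸ N) ⧸ U.map (QuotientGroup.mk' N) where
  toFun := tlift (fun a x => a • Quotient.liftOn' x
      (fun g => (((g : G ⧸ N)) : (G ⧸ N) ⧸ U.map (QuotientGroup.mk' N))) (by
        intro g h hgh
        rw [QuotientGroup.leftRel_apply] at hgh
        exact QuotientGroup.eq.2 ⟨_, hgh, rfl⟩)) (by
      intro g a x
      induction a using QuotientGroup.induction_on with | _ a => ?_
      induction x using QuotientGroup.induction_on with | _ x => ?_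
      refine congrArg (QuotientGroup.mk (s := U.map (QuotientGroup.mk' N))) ?_
      refine congrArg (QuotientGroup.mk (s := N)) (?_ : a * g * (g⁻¹ * x) = a * x)
      group)
  invFun y := Quotient.liftOn' y (fun a => tmk a ((1 : G) : G ⧸ U)) (by
    intro a b hab
    rw [QuotientGroup.leftRel_apply] at hab
    obtain ⟨g, hg, hgb⟩ := hab
    have hb : b = a * (g : G ⧸ N) := by rw [← QuotientGroup.mk'_apply, hgb, mul_inv_cancel_left]
    have h1 : ((1 : G) : G ⧸ U) = g • ((1 : G) : G ⧸ U) :=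
      QuotientGroup.eq.2 (by simpa using hg)
    change tmk a _ = tmk b _
    rw [hb, ← tmk_quotient_eq, ← h1])
  left_inv t := by
    induction t using tensor_ind with | _ a x => ?_
    induction x using QuotientGroup.induction_on with | _ x => ?_
    change tmk (a * (x : G ⧸ N)) ((1 : G) : G ⧸ U) = tmk a (x : G ⧸ U)
    rw [← tmk_quotient_eq]
    exact congrArg (tmk a) (congrArg (QuotientGroup.mk (s := U)) (mul_one x))
  right_inv y := by
    induction y using QuotientGroup.induction_on with | _ a => ?_
    exact congrArg (QuotientGroup.mk (s := U.map (QuotientGroup.mk' N))) (mul_one a)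

theorem tensorQuotientEquiv_smul (N U : Subgroup G) [N.Normal] (b : G ⧸ N)
    (t : Tensor G (G ⧸ N) (G ⧸ U)) :
    tensorQuotientEquiv N U (b • t) = b • tensorQuotientEquiv N U t := by
  induction t using tensor_ind with | _ a x => ?_
  induction x using QuotientGroup.induction_on with | _ x => ?_
  exact congrArg (QuotientGroup.mk (s := U.map (QuotientGroup.mk' N))) (mul_assoc b a x)

variable [Finite G]

theorem xiMap_bracket (N : Subgroup G) [N.Normal] (V U : Subgroup G) (h : U ≤ V) :
    xiMap (H := G ⧸ N) (G ⧸ N) (bracket V U h)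
      = bracket (V.map (QuotientGroup.mk' N)) (U.map (QuotientGroup.mk' N))
          (Subgroup.map_mono h) := by
  unfold bracket
  rw [xiMap_piCls]
  refine congrArg (QuotientAddGroup.mk (s := relations (G ⧸ N))) (cls_eq ?_)
  refine ⟨tensorQuotientEquiv N U, tensorQuotientEquiv N V, tensorQuotientEquiv_smul N U,
    tensorQuotientEquiv_smul N V, fun t => ?_⟩
  induction t using tensor_ind with | _ a x => ?_
  induction x using QuotientGroup.induction_on with | _ x => ?_
  rfl

/-- The element `1 ⊗ ⟨V, U⟩_G` of `KΞ(G)` if `U ≤ V`, and `0` otherwise. -/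
noncomputable def slice (K : Type*) [Field K] (V U : Subgroup G) : KXi K G :=
  if h : U ≤ V then (1 : K) ⊗ₜ[ℤ] bracket V U h else 0

variable (K : Type*) [Field K]

theorem deflation_slice (N : Subgroup G) [N.Normal] {V U : Subgroup G} (h : U ≤ V) :
    deflation K N (slice K V U)
      = slice K (V.map (QuotientGroup.mk' N)) (U.map (QuotientGroup.mk' N)) := by
  rw [slice, slice, dif_pos h, dif_pos (Subgroup.map_mono h), ← xiMap_bracket]
  rfl

theorem finsum_subtype_eq_sum {α M : Type*} [Fintype α] [AddCommMonoid M] {p : α → Prop}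
    (f : Subtype p → M) (g : α → M) (h : ∀ x, f x = g x) (h0 : ∀ x, ¬ p x → g x = 0) :
    ∑ᶠ x, f x = ∑ x, g x := by
  rw [finsum_eq_sum_of_fintype, Finset.sum_congr rfl fun x _ => h x,
    ← Finset.sum_subtype (Finset.univ.filter p) (by simp) g, Finset.sum_filter]
  refine Finset.sum_congr rfl fun x _ => ?_
  split_ifs with hx
  · rfl
  · exact (h0 x hx).symm

attribute [local instance] subgroupFintype

/-- Every coefficient becomes a function of `U` times a function of `V`, so the two sums can be
grouped by fibres independently. The Möbius function enforces `U ≤ S` and `V ≤ T` by itself; only `S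
≤ V` needs an indicator. -/
theorem xi_eq_sum (T S : Subgroup G) :
    xi K T S = ((Nat.card (nz T ⊓ nz S : Subgroup G) : K))⁻¹ •
      ∑ U : Subgroup G, ∑ V : Subgroup G,
        (((Nat.card U : K) * (mu U S : K)) * ((if S ≤ V then 1 else 0) * (mu V T : K))) •
          slice K V U := by
  unfold xi
  congr 1
  refine finsum_subtype_eq_sum _ _ (fun U => ?_) (fun U hU => ?_)
  · refine finsum_subtype_eq_sum _ _ (fun V => ?_) (fun V hV => ?_)
    · rw [slice, dif_pos (U.2.trans V.2.1), if_pos V.2.1, one_mul]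
    · rw [not_and_or] at hV
      rcases hV with hV | hV
      · simp [hV]
      · simp [mu_eq_zero_of_not_le hV]
  · simp [mu_eq_zero_of_not_le hU]

variable {K}

theorem deflation_xi [CharZero K] (N : Subgroup G) [N.Normal] (T S : Subgroup G) :
    deflation K N (xi K T S) =
      ((Nat.card (nz T ⊓ nz S : Subgroup G) : K)⁻¹ *
        (Nat.card (nz (T.map (QuotientGroup.mk' N)) ⊓ nz (S.map (QuotientGroup.mk' N)) :
          Subgroup (G ⧸ N)) : K) *
        (Nat.card (S.map (QuotientGroup.mk' N)) : K)⁻¹ *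
        ((∑ U : Subgroup G with U.map (QuotientGroup.mk' N) = S.map (QuotientGroup.mk' N),
            (Nat.card U : K) * (mu U S : K)) *
          ∑ V : Subgroup G with V.map (QuotientGroup.mk' N) = T.map (QuotientGroup.mk' N),
            (if S ≤ V then 1 else 0) * (mu V T : K))) •
      xi K (T.map (QuotientGroup.mk' N)) (S.map (QuotientGroup.mk' N)) := by
  set φ := QuotientGroup.mk' N with hφ
  set β : K := ∑ V : Subgroup G with V.map φ = T.map φ, (if S ≤ V then 1 else 0) * (mu V T : K)
    with hβ
  -- The fibre sum over `φ(S)` equals `|φ(S)| α`, where `α` is the actual proportionality factor;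
  -- this accounts for the inverse of `|φ(S)|` in the statement.
  rw [sum_card_mu_map_eq φ S (S.map φ), mu_refl]
  set α : K := ∑ U : Subgroup G with U.map φ = S.map φ,
    (Nat.card (U ⊓ φ.ker : Subgroup G) : K) * (mu U S : K) with hα
  have hsum : ∑ U : Subgroup G, ∑ V : Subgroup G,
      (((Nat.card U : K) * (mu U S : K)) * ((if S ≤ V then 1 else 0) * (mu V T : K))) •
        slice K (V.map φ) (U.map φ)
      = (α * β) • ∑ A : Subgroup (G ⧸ N), ∑ B : Subgroup (G ⧸ N),
        (((Nat.card A : K) * (mu A (S.map φ) : K)) *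
          ((if S.map φ ≤ B then 1 else 0) * (mu B (T.map φ) : K))) • slice K B A := by
    rw [← Finset.sum_fiberwise _ (fun U : Subgroup G => U.map φ), Finset.smul_sum]
    refine Finset.sum_congr rfl fun A _ => ?_
    rw [Finset.sum_comm, ← Finset.sum_fiberwise _ (fun V : Subgroup G => V.map φ),
      Finset.smul_sum]
    refine Finset.sum_congr rfl fun B _ => ?_
    have h1 : ∀ V ∈ Finset.univ.filter (fun V : Subgroup G => V.map φ = B),
        ∑ U : Subgroup G with U.map φ = A,
          (((Nat.card U : K) * (mu U S : K)) * ((if S ≤ V then 1 else 0) * (mu V T : K))) •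
            slice K (V.map φ) (U.map φ)
        = ((∑ U : Subgroup G with U.map φ = A, (Nat.card U : K) * (mu U S : K)) *
            ((if S ≤ V then 1 else 0) * (mu V T : K))) • slice K B A := by
      intro V hV
      rw [Finset.sum_mul, Finset.sum_smul]
      refine Finset.sum_congr rfl fun U hU => ?_
      rw [(Finset.mem_filter.1 hV).2, (Finset.mem_filter.1 hU).2]
    rw [Finset.sum_congr rfl h1, ← Finset.sum_smul, ← Finset.mul_sum, sum_card_mu_map_eq,
      sum_le_mu_map_eq, smul_smul]
    congr 1
    ring
  have hdef : deflation K N (∑ U : Subgroup G, ∑ V : Subgroup G,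
      (((Nat.card U : K) * (mu U S : K)) * ((if S ≤ V then 1 else 0) * (mu V T : K))) •
        slice K V U) = ∑ U : Subgroup G, ∑ V : Subgroup G,
      (((Nat.card U : K) * (mu U S : K)) * ((if S ≤ V then 1 else 0) * (mu V T : K))) •
        slice K (V.map φ) (U.map φ) := by
    rw [map_sum]
    refine Finset.sum_congr rfl fun U _ => ?_
    rw [map_sum]
    refine Finset.sum_congr rfl fun V _ => ?_
    rw [map_smul]
    -- `slice` is zero by default when `U` is not contained in `V`, although `φ(U) ≤ φ(V)` may still
    -- hold. Such pairs are harmless, as their coefficient vanishes.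
    by_cases hU : U ≤ S
    · by_cases hV : S ≤ V
      · rw [deflation_slice K N (hU.trans hV)]
      · simp [hV]
    · simp [mu_eq_zero_of_not_le hU]
  rw [xi_eq_sum, map_smul, hdef, hsum, xi_eq_sum K (T.map φ) (S.map φ), smul_smul, smul_smul]
  congr 1
  have h1 : (Nat.card (nz (T.map φ) ⊓ nz (S.map φ) : Subgroup (G ⧸ N)) : K) ≠ 0 :=
    Nat.cast_ne_zero.2 Nat.card_pos.ne'
  have h2 : (Nat.card (S.map φ) : K) ≠ 0 := Nat.cast_ne_zero.2 Nat.card_pos.ne'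
  field_simp
  push_cast
  ring

theorem mConst_cast [CharZero K] (S N : Subgroup G) :
    (mConst S N : K) = ((S ⊔ N).relIndex (nz (S ⊔ N)) : K) / (Nat.card (nz S) : K) *
      ((∑ U : Subgroup G with U ⊔ N = S ⊔ N, (Nat.card U : K) * (mu U S : K)) *
        ∑ V : Subgroup G with V ⊔ N = ⊤, (if S ≤ V then 1 else 0) * (mu V ⊤ : K)) := by
  have h : mConst S N = ((S ⊔ N).relIndex (nz (S ⊔ N)) : ℚ) / (Nat.card (nz S) : ℚ) *
      ((∑ U : Subgroup G with U ⊔ N = S ⊔ N, (Nat.card U : ℚ) * (mu U S : ℚ)) *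
        ∑ V : Subgroup G with V ⊔ N = ⊤, (if S ≤ V then 1 else 0) * (mu V ⊤ : ℚ)) := by
    unfold mConst
    congr 1
    rw [Finset.sum_mul, Finset.sum_filter]
    refine finsum_subtype_eq_sum _ _ (fun U => ?_) (fun U hU => ?_)
    · rw [if_pos U.2.2, Finset.mul_sum, Finset.sum_filter]
      refine finsum_subtype_eq_sum _ _ (fun V => ?_) (fun V hV => ?_)
      · rw [if_pos V.2.2, if_pos V.2.1, one_mul]
      · rw [not_and_or] at hV
        rcases hV with hV | hV <;> simp [hV]
    · rw [not_and_or] at hU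
      rcases hU with hU | hU
      · simp [mu_eq_zero_of_not_le hU]
      · simp [hU]
  rw [h]
  push_cast
  simp only [apply_ite (Rat.cast : ℚ → K), Rat.cast_one, Rat.cast_zero]

end deflation

end SliceBurnside

namespace SliceBurnside

/-! ### Joins with `N` as images in `G/N` -/

section images

variable {G : Type*} [Group G]

theorem sup_eq_sup_iff_map_mk' (N U V : Subgroup G) [N.Normal] :
    U ⊔ N = V ⊔ N ↔ U.map (QuotientGroup.mk' N) = V.map (QuotientGroup.mk' N) := by
  rw [Subgroup.map_eq_map_iff, QuotientGroup.ker_mk']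

/-- `T ∩ N` is the kernel of `T → G/N`, so joins with it in `T` can be compared inside `G/N`,
without passing through `T/(T ∩ N) ≅ TN/N`. -/
theorem subgroupOf_sup_eq_iff (N T : Subgroup G) [N.Normal] (U V : Subgroup T) :
    U ⊔ N.subgroupOf T = V ⊔ N.subgroupOf T ↔
      (U.map T.subtype).map (QuotientGroup.mk' N)
        = (V.map T.subtype).map (QuotientGroup.mk' N) := by
  have hker : ((QuotientGroup.mk' N).comp T.subtype).ker = N.subgroupOf T := by
    rw [← MonoidHom.comap_ker, QuotientGroup.ker_mk']
    rfl
  rw [Subgroup.map_map, Subgroup.map_map, Subgroup.map_eq_map_iff, hker]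

end images

/-! ### Comparison of Möbius sums in `T` with Möbius sums in `G` -/

section transfer

open scoped Classical

attribute [local instance] subgroupFintype

variable {G : Type*} [Group G] [Finite G]

theorem sum_map_subtype {M : Type*} [AddCommMonoid M] (T : Subgroup G) (f : Subgroup G → M)
    (hf : ∀ V, ¬ V ≤ T → f V = 0) :
    ∑ U : Subgroup T, f (U.map T.subtype) = ∑ V : Subgroup G, f V := by
  refine Fintype.sum_of_injective (fun U : Subgroup T => U.map T.subtype)
    (Subgroup.map_injective T.subtype_injective) _ _ (fun V hV => hf V fun h => hV ?_)
    fun _ => rfl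
  exact ⟨V.subgroupOf T, Subgroup.map_subgroupOf_eq_of_le h⟩

/-- The subgroups of `G` contained in `W` are all subgroups of `T`, so both functions of `U` have
the same sums over upper sets, and these determine them. -/
theorem mu_map_subtype (T : Subgroup G) (U W : Subgroup T) :
    mu (U.map T.subtype) (W.map T.subtype) = mu U W := by
  rw [← sub_eq_zero]
  refine eq_zero_of_upper_sums
    (fun U : Subgroup T => mu (U.map T.subtype) (W.map T.subtype) - mu U W) ⊥ ?_ U bot_le
  intro C _
  have hinj := Subgroup.map_injective T.subtype_injective
  rw [Finset.sum_sub_distrib, sum_mu, sub_eq_zero, Finset.sum_filter]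
  have h := sum_mu (C.map T.subtype) (W.map T.subtype)
  rw [Finset.sum_filter, ← sum_map_subtype T] at h
  · simp only [hinj.eq_iff] at h
    rw [← h]
    refine Finset.sum_congr rfl fun U _ => ?_
    simp only [Subgroup.map_le_map_iff_of_injective T.subtype_injective]
  · intro V hV
    rw [mu_eq_zero_of_not_le fun h => hV (h.trans (Subgroup.map_subtype_le W)), ite_self]

variable {R : Type*} [CommRing R]

theorem mu_map_subtype_subgroupOf {T S : Subgroup G} (h : S ≤ T) (U : Subgroup T) :
    mu (U.map T.subtype) S = mu U (S.subgroupOf T) := by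
  rw [← mu_map_subtype, Subgroup.map_subgroupOf_eq_of_le h]

theorem sum_card_mu_subgroupOf (N : Subgroup G) [N.Normal] {T S : Subgroup G} (h : S ≤ T) :
    ∑ U : Subgroup T with U ⊔ N.subgroupOf T = S.subgroupOf T ⊔ N.subgroupOf T,
        (Nat.card U : R) * (mu U (S.subgroupOf T) : R)
      = ∑ U : Subgroup G with U.map (QuotientGroup.mk' N) = S.map (QuotientGroup.mk' N),
        (Nat.card U : R) * (mu U S : R) := by
  rw [Finset.sum_filter, Finset.sum_filter, ← sum_map_subtype T]
  · refine Finset.sum_congr rfl fun U _ => ?_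
    rw [mu_map_subtype_subgroupOf h, Subgroup.card_map_of_injective T.subtype_injective]
    simp only [subgroupOf_sup_eq_iff, Subgroup.map_subgroupOf_eq_of_le h]
  · intro V hV
    rw [mu_eq_zero_of_not_le fun h' => hV (h'.trans h)]
    simp

theorem sum_le_mu_subgroupOf (N : Subgroup G) [N.Normal] {T S : Subgroup G} (h : S ≤ T) :
    ∑ V : Subgroup T with V ⊔ N.subgroupOf T = ⊤,
        (if S.subgroupOf T ≤ V then 1 else 0) * (mu V ⊤ : R)
      = ∑ V : Subgroup G with V.map (QuotientGroup.mk' N) = T.map (QuotientGroup.mk' N),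
        (if S ≤ V then 1 else 0) * (mu V T : R) := by
  rw [Finset.sum_filter, Finset.sum_filter, ← sum_map_subtype T]
  · refine Finset.sum_congr rfl fun V _ => ?_
    have h1 : S.subgroupOf T ≤ V ↔ S ≤ V.map T.subtype := by
      rw [← Subgroup.map_le_map_iff_of_injective T.subtype_injective,
        Subgroup.map_subgroupOf_eq_of_le h]
    have h2 : V ⊔ N.subgroupOf T = ⊤ ↔
        (V.map T.subtype).map (QuotientGroup.mk' N) = T.map (QuotientGroup.mk' N) := by
      rw [← top_sup_eq (N.subgroupOf T), subgroupOf_sup_eq_iff, ← MonoidHom.range_eq_map,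
        T.range_subtype]
    rw [mu_map_subtype_subgroupOf le_rfl, Subgroup.subgroupOf_self]
    simp only [h1, h2]
  · intro V hV
    rw [mu_eq_zero_of_not_le hV]
    simp

theorem mConst_cast_of_normal {K : Type*} [Field K] [CharZero K] (N : Subgroup G) [N.Normal]
    (S : Subgroup G) :
    (mConst S N : K) = ((S ⊔ N).relIndex (nz (S ⊔ N)) : K) / (Nat.card (nz S) : K) *
      ((∑ U : Subgroup G with U.map (QuotientGroup.mk' N) = S.map (QuotientGroup.mk' N),
          (Nat.card U : K) * (mu U S : K)) *
        ∑ V : Subgroup G with V.map (QuotientGroup.mk' N) = (⊤ : Subgroup G).map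
          (QuotientGroup.mk' N), (if S ≤ V then 1 else 0) * (mu V ⊤ : K)) := by
  rw [mConst_cast]
  congr 2
  · exact Finset.sum_congr (Finset.filter_congr fun U _ => sup_eq_sup_iff_map_mk' N U S)
      fun _ _ => rfl
  · refine Finset.sum_congr (Finset.filter_congr fun V _ => ?_) fun _ _ => rfl
    rw [← sup_eq_sup_iff_map_mk', top_sup_eq]

end transfer

/-! ### Orders of normalizers under the correspondence theorem -/

section cardinalities

variable {G : Type*} [Group G]

theorem sup_eq_comap_mk' (N S : Subgroup G) [N.Normal] :
    S ⊔ N = (S.map (QuotientGroup.mk' N)).comap (QuotientGroup.mk' N) := by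
  rw [Subgroup.comap_map_eq, QuotientGroup.ker_mk']

theorem nz_sup (N S : Subgroup G) [N.Normal] :
    nz (S ⊔ N) = (nz (S.map (QuotientGroup.mk' N))).comap (QuotientGroup.mk' N) := by
  rw [sup_eq_comap_mk', nz, nz,
    Subgroup.comap_normalizer_eq_of_surjective _ (QuotientGroup.mk'_surjective N)]

theorem card_comap_mk' (N : Subgroup G) [N.Normal] (C : Subgroup (G ⧸ N)) :
    Nat.card (C.comap (QuotientGroup.mk' N)) = Nat.card C * Nat.card N := by
  rw [card_comap, QuotientGroup.range_mk', top_inf_eq, QuotientGroup.ker_mk']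

theorem relIndex_mul_card_of_le {A B : Subgroup G} (h : A ≤ B) :
    A.relIndex B * Nat.card A = Nat.card B := by
  rw [mul_comm, Subgroup.relIndex, ← Subgroup.card_mul_index (A.subgroupOf B),
    ← Subgroup.card_map_of_injective (K := A.subgroupOf B) B.subtype_injective,
    Subgroup.map_subgroupOf_eq_of_le h]

theorem relIndex_nz_sup_mul_card [Finite G] (N S : Subgroup G) [N.Normal] :
    (S ⊔ N).relIndex (nz (S ⊔ N)) * Nat.card (S.map (QuotientGroup.mk' N))
      = Nat.card (nz (S.map (QuotientGroup.mk' N))) := by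
  have h := relIndex_mul_card_of_le (A := S ⊔ N) (B := nz (S ⊔ N)) Subgroup.le_normalizer
  have h1 : Nat.card (S ⊔ N : Subgroup G)
      = Nat.card (S.map (QuotientGroup.mk' N)) * Nat.card N := by
    rw [sup_eq_comap_mk', card_comap_mk']
  have h2 : Nat.card (nz (S ⊔ N))
      = Nat.card (nz (S.map (QuotientGroup.mk' N))) * Nat.card N := by
    rw [nz_sup, card_comap_mk']
  rw [h1, h2, ← mul_assoc] at h
  exact Nat.eq_of_mul_eq_mul_right Nat.card_pos h

/-- Apply the correspondence to `ψ : T → G/N`, of image `TN/N` and kernel `T ∩ N`: as `SN/N` lies in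
the image of `ψ`, its normalizer pulls back to the normalizer of `S(T ∩ N)` in `T`. The order of the
kernel then cancels. -/
theorem relIndex_nz_subgroupOf_sup_mul_card [Finite G] (N : Subgroup G) [N.Normal]
    {T S : Subgroup G} (h : S ≤ T) :
    (S.subgroupOf T ⊔ N.subgroupOf T).relIndex (nz (S.subgroupOf T ⊔ N.subgroupOf T)) *
        Nat.card (S.map (QuotientGroup.mk' N))
      = Nat.card (T.map (QuotientGroup.mk' N) ⊓ nz (S.map (QuotientGroup.mk' N)) :
          Subgroup (G ⧸ N)) := by
  set ψ : T →* G ⧸ N := (QuotientGroup.mk' N).comp T.subtype with hψ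
  have hker : ψ.ker = N.subgroupOf T := by
    rw [← MonoidHom.comap_ker, QuotientGroup.ker_mk']
    rfl
  have hrange : ψ.range = T.map (QuotientGroup.mk' N) := by
    rw [hψ, MonoidHom.range_comp, T.range_subtype]
  have hle : S.map (QuotientGroup.mk' N) ≤ ψ.range := hrange ▸ Subgroup.map_mono h
  have hsup : S.subgroupOf T ⊔ N.subgroupOf T = (S.map (QuotientGroup.mk' N)).comap ψ := by
    rw [← hker, ← Subgroup.comap_map_eq, hψ, ← Subgroup.map_map,
      Subgroup.map_subgroupOf_eq_of_le h]
  have hnz : nz (S.subgroupOf T ⊔ N.subgroupOf T)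
      = (nz (S.map (QuotientGroup.mk' N))).comap ψ := by
    rw [hsup, nz, nz, Subgroup.comap_normalizer_eq_of_le_range hle]
  have hrel := relIndex_mul_card_of_le (A := S.subgroupOf T ⊔ N.subgroupOf T)
    (B := nz (S.subgroupOf T ⊔ N.subgroupOf T)) Subgroup.le_normalizer
  have h1 : Nat.card (S.subgroupOf T ⊔ N.subgroupOf T : Subgroup T)
      = Nat.card (S.map (QuotientGroup.mk' N)) * Nat.card ψ.ker := by
    rw [hsup, card_comap, inf_eq_right.2 hle]
  have h2 : Nat.card (nz (S.subgroupOf T ⊔ N.subgroupOf T))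
      = Nat.card (T.map (QuotientGroup.mk' N) ⊓ nz (S.map (QuotientGroup.mk' N)) :
          Subgroup (G ⧸ N)) * Nat.card ψ.ker := by
    rw [hnz, card_comap, hrange]
  rw [h1, h2, ← mul_assoc] at hrel
  exact Nat.eq_of_mul_eq_mul_right Nat.card_pos hrel

theorem card_nz_subgroupOf {T S : Subgroup G} (h : S ≤ T) :
    Nat.card (nz (S.subgroupOf T)) = Nat.card (T ⊓ nz S : Subgroup G) := by
  have hle : S ≤ T.subtype.range := by rwa [T.range_subtype]
  have : nz (S.subgroupOf T) = (nz S).comap T.subtype :=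
    (Subgroup.comap_normalizer_eq_of_le_range hle).symm
  rw [this, card_comap, T.range_subtype, T.ker_subtype, Subgroup.card_bot, mul_one]

end cardinalities

end SliceBurnside

/-! ### The proposition: matching the constants -/

open SliceBurnside in
theorem proposition4p4 (K : Type*) [Field K] [CharZero K] {G : Type u} [Group G] [Finite G]
    (N : Subgroup G) [N.Normal] :
    (∀ S : Subgroup G,
      deflation K N (xi K ⊤ S) =
        (mConst S N : K) • xi K (⊤ : Subgroup (G ⧸ N)) (S.map (QuotientGroup.mk' N))) ∧
    ∀ T S : Subgroup G, S ≤ T →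
      deflation K N (xi K T S) =
        (((Nat.card (T ⊓ nz S : Subgroup G) : K) *
            (Nat.card (nz (T ⊔ N) ⊓ nz (S ⊔ N) : Subgroup G) : K)) /
          ((Nat.card (nz T ⊓ nz S : Subgroup G) : K) *
            (Nat.card ((T ⊔ N) ⊓ nz (S ⊔ N) : Subgroup G) : K)) *
          (mConst (S.subgroupOf T) (N.subgroupOf T) : K)) •
        xi K (T.map (QuotientGroup.mk' N)) (S.map (QuotientGroup.mk' N)) := by
  have hpos : ∀ {G : Type u} [Group G] [Finite G] (A : Subgroup G), (Nat.card A : K) ≠ 0 :=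
    fun A => Nat.cast_ne_zero.2 Nat.card_pos.ne'
  have htop : ∀ {G : Type u} [Group G], nz (⊤ : Subgroup G) = ⊤ := Subgroup.normalizer_eq_top _
  refine ⟨fun S => ?_, fun T S h => ?_⟩
  · have hφ : (⊤ : Subgroup G).map (QuotientGroup.mk' N) = ⊤ :=
      Subgroup.map_top_of_surjective _ (QuotientGroup.mk'_surjective N)
    rw [deflation_xi, mConst_cast_of_normal, hφ, htop, htop, top_inf_eq, top_inf_eq,
      ← relIndex_nz_sup_mul_card N S]
    congr 1
    have h1 := hpos (S.map (QuotientGroup.mk' N))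
    have h2 := hpos (nz S)
    push_cast
    field_simp
  · have h1 : Nat.card (nz (T ⊔ N) ⊓ nz (S ⊔ N) : Subgroup G)
        = Nat.card (nz (T.map (QuotientGroup.mk' N)) ⊓ nz (S.map (QuotientGroup.mk' N)) :
            Subgroup (G ⧸ N)) * Nat.card N := by
      rw [nz_sup, nz_sup, ← Subgroup.comap_inf, card_comap_mk']
    have h2 : Nat.card ((T ⊔ N) ⊓ nz (S ⊔ N) : Subgroup G)
        = Nat.card (T.map (QuotientGroup.mk' N) ⊓ nz (S.map (QuotientGroup.mk' N)) :
            Subgroup (G ⧸ N)) * Nat.card N := by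
      rw [sup_eq_comap_mk' N T, nz_sup, ← Subgroup.comap_inf, card_comap_mk']
    have h3 := hpos (T.map (QuotientGroup.mk' N) ⊓ nz (S.map (QuotientGroup.mk' N)))
    rw [deflation_xi, mConst_cast, sum_card_mu_subgroupOf N h, sum_le_mu_subgroupOf N h,
      card_nz_subgroupOf h, h1, h2]
    -- The order of `N_{TN/N}(SN/N)` is split as the index occurring in `m_{T,S,T∩N}` times
    -- `|SN/N|`. Doing the same in `h3` shows that this index is nonzero in `K`, so it can be
    -- cancelled.
    rw [← relIndex_nz_subgroupOf_sup_mul_card N h] at h3 ⊢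
    congr 1
    have h4 := hpos (S.map (QuotientGroup.mk' N))
    have h5 := hpos (nz T ⊓ nz S)
    have h6 := hpos (T ⊓ nz S)
    have h7 := hpos N
    push_cast at h3 ⊢
    have h8 := left_ne_zero_of_mul h3
    field_simp
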